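/- An $m$-dimensional reproducing kernel Hilbert space (RKHS) is an $m$-dimensional complex inner product space $H$ together with a distinguished basis $k_1,\dots,k_m$ (the reproducing kernels), attached to points $x_1,\dots,x_m$; a vector $h\in H$ is regarded as the function $h(x_i)=\langle h,k_i\rangle$ on $X(H)=\{x_1,\dots,x_m\}$. Write $k_{ij}=\langle k_i,k_j\rangle$ and assume, as always for these spaces, that $H$ is irreducible, i.e. $k_{ij}\neq 0$ for all $i,j$. Put $$\delta_{ij}=\Bigl(1-\frac{|k_{ij}|^2}{k_{ii}k_{jj}}\Bigr)^{1/2},\qquad LF_{ijk}=\frac1{\delta_{ij}}\left|1-\frac{k_{ji}k_{ik}}{k_{jk}k_{ii}}\right| .$$ For a set $\Lambda$ of indices let $H(\Lambda)$ be the span of $\{k_i\}_{i\in\Lambda}$, an RKHS with these kernels. For a matrix-valued function $F:X(H)\to\mathbb C^{s\times t}$ let $M_F:H\otimes\mathbb C^t\to H\otimes\mathbb C^s$ be the multiplier operator $(M_Fh)(x)=F(x)h(x)$, with its operator norm. $H$ has the complete Pick property (CPP) if, for every set $\Lambda$ of indices and all $s,t$, every $F:X(H(\Lambda))\to\mathbb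 C^{s\times t}$ whose multiplier operator on $H(\Lambda)$ has norm $1$ extends to a function $G:X(H)\to\mathbb C^{s\times t}$ whose multiplier operator on $H$ has norm $1$. Two RKHS $H,\widetilde H$ with kernels $k_x$, $\tilde k_y$ are rescalings of each other, $H\sim\widetilde H$, if there are a bijection $\Xi:X(H)\to X(\widetilde H)$ and a nowhere vanishing function $\gamma:X(H)\to\mathbb C$ with $\langle\tilde k_{\Xi(x)},\tilde k_{\Xi(y)}\rangle=\gamma(x)\overline{\gamma(y)}\langle k_x,k_y\rangle$ for all $x,y\in X(H)$. Finally, for a finite subset $Y$ of the open unit disk $\mathbb D\subset\mathbb C$, let $DA_1(Y)$ be the span, in the Hardy space $DA_1=H^2$ of the disk, of the kernels $k_y(z)=(1-\bar y z)^{-1}$, $y\in Y$, an RKHS with point set $Y$. **Proposition 6.10.** Let $H$ be an irreducible $m$-dimensional RKHS with $m\ge 4$, and suppose that $H(\Lambda)$ has the CPP for every four-element set $\Lambda\subset\{1,\dots,m\}$. Then $H\sim DA_1(Y)$ for some finite $Y\subset\mathbb D$ (that is, $H$ is an r-Pick space) if and only if $LF_{ijk}=\delta_{ik}$ for all $1\le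 i<j<k\le m$. -/

import Mathlib

namespace FinRKHS

open scoped ComplexConjugate

/-! A finite dimensional reproducing kernel Hilbert space is a complex inner product space `H`
together with a distinguished basis `k`, the reproducing kernels. The index type `ι` of the basis
is the point set `X(H)`, and `h ∈ H` is the function `i ↦ ⟨h, k i⟩` on it. Mathlib's `inner ℂ` is
linear in the second argument, so `⟨u, v⟩` (linear in `u`) is `inner ℂ v u`. -/

section Basic

variable {ι H : Type*} [NormedAddCommGroup H] [InnerProductSpace ℂ H]

/-- The Gram matrix entry `k_ij = ⟨k_i, k_j⟩ = k_i(x_j)`. -/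
noncomputable def gram (k : Module.Basis ι ℂ H) (i j : ι) : ℂ := inner ℂ (k j) (k i)

/-- No two kernel functions are orthogonal. (Distinct ones are linearly independent since `k` is a
basis.) -/
def IsIrreducible (k : Module.Basis ι ℂ H) : Prop := ∀ i j, i ≠ j → gram k i j ≠ 0

/-- The distance `δ_ij`, the nonnegative root of `1 - |k_ij|² / (k_ii k_jj)`. -/
noncomputable def delta (k : Module.Basis ι ℂ H) (i j : ι) : ℝ :=
  Real.sqrt (1 - ‖gram k i j‖ ^ 2 / ((gram k i i).re * (gram k j j).re))

/-- The invariant `LF_ijl = |1 - k_ji k_il / (k_jl k_ii)| / δ_ij`. -/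
noncomputable def LF (k : Module.Basis ι ℂ H) (i j l : ι) : ℝ :=
  (1 / delta k i j) * ‖1 - (gram k j i * gram k i l) / (gram k j l * gram k i i)‖

/-- Evaluation of the elements of `H` as functions on the point set: `h ↦ (i ↦ ⟨h, k i⟩)`. -/
noncomputable def evalLin (k : Module.Basis ι ℂ H) : H →ₗ[ℂ] (ι → ℂ) where
  toFun h i := inner ℂ (k i) h
  map_add' f g := by ext i; exact inner_add_right _ _ _
  map_smul' c f := by ext i; exact inner_smul_right _ _ _

theorem evalLin_injective (k : Module.Basis ι ℂ H) : Function.Injective (evalLin k) := by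
  intro f g h
  rw [← sub_eq_zero, ← inner_self_eq_zero (𝕜 := ℂ)]
  have h0 : ∀ i, inner ℂ (k i) (f - g) = 0 := fun i => by
    rw [inner_sub_right]; exact sub_eq_zero.2 (congrFun h i)
  have h1 : ∀ v : H, inner ℂ v (f - g) = 0 := fun v => by
    have hv : v ∈ Submodule.span ℂ (Set.range k) := k.mem_span v
    induction hv using Submodule.span_induction with
    | mem x hx => obtain ⟨i, rfl⟩ := hx; exact h0 i
    | zero => exact inner_zero_left _
    | add x y _ _ hx hy => rw [inner_add_left, hx, hy, add_zero]
    | smul a x _ hx => rw [inner_smul_left, hx, mul_zero]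
  exact h1 _

theorem evalLin_bijective [Finite ι] (k : Module.Basis ι ℂ H) :
    Function.Bijective (evalLin k) := by
  have := Fintype.ofFinite ι
  have : FiniteDimensional ℂ H := k.finiteDimensional_of_finite
  refine ⟨evalLin_injective k, ?_⟩
  refine (LinearMap.injective_iff_surjective_of_finrank_eq_finrank ?_).1 (evalLin_injective k)
  rw [Module.finrank_eq_card_basis k, Module.finrank_fintype_fun_eq_card]

/-- Every function on the point set is the function of exactly one element of `H`. -/
noncomputable def evalEquiv [Finite ι] (k : Module.Basis ι ℂ H) : H ≃ₗ[ℂ] (ι → ℂ) :=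
  LinearEquiv.ofBijective (evalLin k) (evalLin_bijective k)

/-- The multiplier operator of a matrix valued symbol `F`, from `H ⊗ ℂ^t` to `H ⊗ ℂ^s` (Hilbert
direct sums of copies of `H`): it sends the `ℂ^t`-valued function `h` to the `ℂ^s`-valued function
`i ↦ F(i) h(i)`. For `s = t = 1` this is the scalar multiplier operator. -/
noncomputable def multOp [Finite ι] (k : Module.Basis ι ℂ H) {s t : ℕ}
    (F : ι → Matrix (Fin s) (Fin t) ℂ) :
    PiLp 2 (fun _ : Fin t => H) →ₗ[ℂ] PiLp 2 (fun _ : Fin s => H) where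
  toFun h := WithLp.toLp 2 fun a =>
    (evalEquiv k).symm fun i => (F i).mulVec (fun b => evalEquiv k (h b) i) a
  map_add' f g := by
    ext a
    simp only [PiLp.add_apply, map_add, Pi.add_apply]
    rw [← map_add]
    congr 1
    ext i
    exact congrFun (Matrix.mulVec_add (F i) (fun b => evalEquiv k (f b) i) _) a
  map_smul' c f := by
    ext a
    simp only [PiLp.smul_apply, map_smul, RingHom.id_apply]
    rw [← map_smul]
    congr 1
    ext i
    exact congrFun (Matrix.mulVec_smul (F i) c (fun b => evalEquiv k (f b) i)) a

/-- The operator norm of the multiplier operator with symbol `F`. -/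
noncomputable def multNorm [Finite ι] (k : Module.Basis ι ℂ H) {s t : ℕ}
    (F : ι → Matrix (Fin s) (Fin t) ℂ) : ℝ :=
  haveI : FiniteDimensional ℂ H := k.finiteDimensional_of_finite
  ‖LinearMap.toContinuousLinearMap (multOp k F)‖

/-- The kernels of `H(Y)`, the subspace spanned by the kernels `k y` with `y ∈ Y`, with point set
`Y`. -/
noncomputable def sub (k : Module.Basis ι ℂ H) (Y : Set ι) :
    Module.Basis Y ℂ (Submodule.span ℂ (Set.range fun y : Y => k y)) :=
  Module.Basis.span (k.linearIndependent.comp _ Subtype.val_injective)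

theorem coe_sub_apply (k : Module.Basis ι ℂ H) (Y : Set ι) (y : Y) :
    ((sub k Y y : Submodule.span ℂ (Set.range fun y : Y => k y)) : H) = k y :=
  congrArg Subtype.val (Module.Basis.span_apply _ y)

/-- The complete Pick property: every matrix valued multiplier of norm one on a subspace spanned by
kernel functions extends to a multiplier of norm one on the whole space. -/
def HasCPP [Finite ι] (k : Module.Basis ι ℂ H) : Prop :=
  ∀ (Y : Set ι) (s t : ℕ) (F : Y → Matrix (Fin s) (Fin t) ℂ), multNorm (sub k Y) F = 1 →
    ∃ G : ι → Matrix (Fin s) (Fin t) ℂ, (∀ y : Y, G y = F y) ∧ multNorm k G = 1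

/-- The space with kernels `k'` is a rescaling of the space with kernels `k`. -/
def IsRescaling {ι' H' : Type*} [NormedAddCommGroup H'] [InnerProductSpace ℂ H']
    (k : Module.Basis ι ℂ H) (k' : Module.Basis ι' ℂ H') : Prop :=
  ∃ (Ξ : ι ≃ ι') (γ : ι → ℂ), (∀ x, γ x ≠ 0) ∧
    ∀ x y, gram k' (Ξ x) (Ξ y) = γ x * conj (γ y) * gram k x y

end Basic

/-! The space `DA₁` is the Hardy space `H²` of the disk: the holomorphic functions
`z ↦ ∑ aₙ zⁿ` with square summable coefficients `a`, which we represent by their coefficients. -/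

section Hardy

/-- `DA₁`, the Hardy space of the disk, as the space of Taylor coefficient sequences. -/
abbrev DA1 : Type := lp (fun _ : ℕ => ℂ) 2

theorem memlp_szego (z : Complex.UnitDisc) :
    Memℓp (fun n : ℕ => conj (z : ℂ) ^ n) 2 := by
  refine (memℓp_gen_iff (by norm_num)).2 ?_
  have h : ∀ n : ℕ, ‖conj (z : ℂ) ^ n‖ ^ (2 : ENNReal).toReal = (‖(z : ℂ)‖ ^ 2) ^ n := by
    intro n
    rw [norm_pow, RCLike.norm_conj]
    norm_num
    rw [← pow_mul, ← pow_mul, mul_comm]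
  simp_rw [h]
  exact summable_geometric_of_lt_one (by positivity) z.sq_norm_lt_one

/-- The reproducing kernel `k_z(w) = 1 / (1 - w * conj z)` of `DA₁`, whose Taylor coefficients are
`conj z ^ n`. -/
noncomputable def szego (z : Complex.UnitDisc) : DA1 := ⟨_, memlp_szego z⟩

/-- The reproducing property: `⟨f, k_z⟩` is the value `f(z)`. -/
theorem inner_szego (z : Complex.UnitDisc) (f : DA1) :
    inner ℂ (szego z) f = ∑' n : ℕ, f n * (z : ℂ) ^ n := by
  rw [lp.inner_eq_tsum]
  simp [szego]

theorem inner_szego_szego (z w : Complex.UnitDisc) :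
    inner ℂ (szego w) (szego z) = 1 / (1 - (w : ℂ) * conj (z : ℂ)) := by
  rw [inner_szego, one_div, ← tsum_geometric_of_norm_lt_one]
  · congr 1
    ext n
    simp [szego, mul_pow, mul_comm]
  · rw [norm_mul, RCLike.norm_conj]
    exact mul_lt_one_of_nonneg_of_lt_one_left (norm_nonneg _) w.norm_lt_one z.norm_lt_one.le

theorem linearIndependent_szego : LinearIndependent ℂ szego := by
  have h0 : LinearIndependent ℂ fun z : Complex.UnitDisc =>
      (powersHom ℂ (conj (z : ℂ)) : Multiplicative ℕ → ℂ) := by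
    refine (linearIndependent_monoidHom (Multiplicative ℕ) ℂ).comp
      (fun z : Complex.UnitDisc => powersHom ℂ (conj (z : ℂ))) ?_
    intro z w h
    have h1 := (powersHom ℂ).injective h
    exact Complex.UnitDisc.coe_injective (star_injective h1)
  let L : DA1 →ₗ[ℂ] (Multiplicative ℕ → ℂ) :=
    { toFun := fun f n => f n.toAdd
      map_add' := fun _ _ => rfl
      map_smul' := fun _ _ => rfl }
  exact LinearIndependent.of_comp L h0

/-- The kernels of `DA₁(Y)`, the subspace of `DA₁` spanned by the kernels `k_y` with `y ∈ Y`. -/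
noncomputable def da1 (Y : Finset Complex.UnitDisc) :
    Module.Basis Y ℂ (Submodule.span ℂ (Set.range fun y : Y => szego y)) :=
  Module.Basis.span (linearIndependent_szego.comp _ Subtype.val_injective)

theorem coe_da1_apply (Y : Finset Complex.UnitDisc) (y : Y) :
    ((da1 Y y : Submodule.span ℂ (Set.range fun y : Y => szego y)) : DA1) = szego y :=
  congrArg Subtype.val (Module.Basis.span_apply _ y)

/-- An r-Pick space is a rescaling of a Pick space `DA₁(Y)`, `Y` a finite subset of the disk. -/
def IsRPick {ι H : Type*} [NormedAddCommGroup H] [InnerProductSpace ℂ H]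
    (k : Module.Basis ι ℂ H) : Prop :=
  ∃ Y : Finset Complex.UnitDisc, IsRescaling k (da1 Y)

end Hardy

end FinRKHS

/-! Fix a base point `o` and consider the Hermitian matrix `defect k o`, which is invariant under
rescaling. Its diagonal is `delta k o a ^ 2`, and `LF k o a b = delta k o b` (for `a ≠ o`) says
exactly that its principal 2 × 2 minor at `a, b` vanishes. For `DA₁(Y)` the matrix is `conj (u a) *
u b` with `u` a disk automorphism sending `o` to 0 (`defect_da1`); conversely such a form makes the
space a rescaling of `DA₁` of the values of `u` (`isRPick_of_defect_eq`).

Vanishing principal minors alone do not force rank one; the phases must match. They give the form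
with `u = defect k o p · / delta k o p` on each triple `o, p, a`. There the adjoint of
multiplication by `u` is isometric on the complement of `k o`, so `u` is a norm one multiplier. A
norm one extension to a fourth point `b` keeps those isometric vectors, and this forces the column
at `b` to be proportional to `conj u` (`HasCPP.exists_defect_eq`). Row `p` fixes the factor, so the
entry at `a, b` is the required one. -/

namespace FinRKHS

open scoped ComplexConjugate

/-! ### Gram matrices and the McCullough-Quiggin matrix. -/

section Gram

variable {ι H : Type*} [NormedAddCommGroup H] [InnerProductSpace ℂ H]

theorem conj_gram (k : Module.Basis ι ℂ H) (i j : ι) : conj (gram k i j) = gram k j i :=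
  inner_conj_symm _ _

theorem gram_self (k : Module.Basis ι ℂ H) (i : ι) : gram k i i = ((‖k i‖ ^ 2 : ℝ) : ℂ) := by
  rw [gram, inner_self_eq_norm_sq_to_K]
  norm_cast

theorem gram_self_ne_zero (k : Module.Basis ι ℂ H) (i : ι) : gram k i i ≠ 0 :=
  inner_self_ne_zero.2 (k.ne_zero i)

theorem IsIrreducible.ne_zero {k : Module.Basis ι ℂ H} (hk : IsIrreducible k) (i j : ι) :
    gram k i j ≠ 0 := by
  by_cases h : i = j
  · exact h ▸ gram_self_ne_zero k i
  · exact hk i j h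

theorem gram_sub (k : Module.Basis ι ℂ H) (Y : Set ι) (x y : Y) :
    gram (sub k Y) x y = gram k x y := by
  simp only [gram, Submodule.coe_inner, coe_sub_apply]

theorem IsIrreducible.sub {k : Module.Basis ι ℂ H} (hk : IsIrreducible k) (Y : Set ι) :
    IsIrreducible (sub k Y) := fun x y h => by
  rw [gram_sub]
  exact hk _ _ fun h' => h (Subtype.ext h')

/-- Two distinct kernel functions satisfy the strict Cauchy-Schwarz inequality. -/
theorem norm_gram_lt (k : Module.Basis ι ℂ H) {i j : ι} (h : i ≠ j) :
    ‖gram k i j‖ < ‖k i‖ * ‖k j‖ := by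
  refine lt_of_le_of_ne ((norm_inner_le_norm _ _).trans_eq (mul_comm _ _)) fun he => ?_
  have h1 : ‖inner ℂ (k j) (k i)‖ = ‖k j‖ * ‖k i‖ := he.trans (mul_comm _ _)
  -- Equality would make `k i` a multiple of `k j`; its `i`-th coordinate then gives a
  -- contradiction.
  obtain ⟨r, -, hr⟩ := (norm_inner_eq_norm_iff (k.ne_zero j) (k.ne_zero i)).1 h1
  have h2 := congrArg (fun v => k.repr v i) hr
  simp [h.symm] at h2

/-- The entry `1 - k_ao k_ob / (k_ab k_oo)` of the McCullough-Quiggin matrix with base point `o`. -/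
noncomputable def defect (k : Module.Basis ι ℂ H) (o a b : ι) : ℂ :=
  1 - (gram k a o * gram k o b) / (gram k a b * gram k o o)

theorem defect_sub (k : Module.Basis ι ℂ H) (Y : Set ι) (o a b : Y) :
    defect (sub k Y) o a b = defect k o a b := by
  simp only [defect, gram_sub]

theorem conj_defect (k : Module.Basis ι ℂ H) (o a b : ι) :
    conj (defect k o a b) = defect k o b a := by
  simp only [defect, map_sub, map_one, map_div₀, map_mul, conj_gram]
  ring

theorem defect_base_left {k : Module.Basis ι ℂ H} (hk : IsIrreducible k) (o b : ι) :
    defect k o o b = 0 := by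
  have h1 := hk.ne_zero o b
  have h2 := gram_self_ne_zero k o
  rw [defect, mul_comm, div_self (mul_ne_zero h1 h2), sub_self]

theorem defect_base_right {k : Module.Basis ι ℂ H} (hk : IsIrreducible k) (o a : ι) :
    defect k o a o = 0 := by
  rw [← conj_defect, defect_base_left hk, map_zero]

theorem gram_mul_one_sub_defect {k : Module.Basis ι ℂ H} (hk : IsIrreducible k) (o a b : ι) :
    gram k a b * (1 - defect k o a b) = gram k a o * gram k o b / gram k o o := by
  have h1 := hk.ne_zero a b
  have h2 := gram_self_ne_zero k o
  rw [defect]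
  field_simp
  ring

theorem one_sub_norm_gram_nonneg (k : Module.Basis ι ℂ H) (i j : ι) :
    0 ≤ 1 - ‖gram k i j‖ ^ 2 / ((gram k i i).re * (gram k j j).re) := by
  rw [gram_self, gram_self, Complex.ofReal_re, Complex.ofReal_re, ← mul_pow, ← div_pow, sub_nonneg]
  refine pow_le_one₀ (by positivity) (div_le_one_of_le₀ ?_ (by positivity))
  exact (norm_inner_le_norm _ _).trans_eq (mul_comm _ _)

theorem defect_self (k : Module.Basis ι ℂ H) (o a : ι) :
    defect k o a a = ((delta k o a ^ 2 : ℝ) : ℂ) := by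
  rw [delta, Real.sq_sqrt (one_sub_norm_gram_nonneg k o a), defect, ← conj_gram k o a, mul_comm,
    Complex.mul_conj, Complex.normSq_eq_norm_sq, gram_self, gram_self]
  simp only [Complex.ofReal_re]
  push_cast
  ring

theorem delta_nonneg (k : Module.Basis ι ℂ H) (i j : ι) : 0 ≤ delta k i j := Real.sqrt_nonneg _

theorem delta_pos (k : Module.Basis ι ℂ H) {i j : ι} (h : i ≠ j) : 0 < delta k i j := by
  have h1 := norm_pos_iff.2 (k.ne_zero i)
  have h2 := norm_pos_iff.2 (k.ne_zero j)
  rw [delta, Real.sqrt_pos, gram_self, gram_self, Complex.ofReal_re, Complex.ofReal_re, ← mul_pow,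
    ← div_pow, sub_pos]
  exact pow_lt_one₀ (by positivity) ((div_lt_one (by positivity)).2 (norm_gram_lt k h)) two_ne_zero

theorem delta_lt_one {k : Module.Basis ι ℂ H} (hk : IsIrreducible k) (i j : ι) :
    delta k i j < 1 := by
  have h1 := norm_pos_iff.2 (k.ne_zero i)
  have h2 := norm_pos_iff.2 (k.ne_zero j)
  have h3 := norm_pos_iff.2 (hk.ne_zero i j)
  rw [delta, Real.sqrt_lt' one_pos, gram_self, gram_self, Complex.ofReal_re, Complex.ofReal_re]
  have : 0 < ‖gram k i j‖ ^ 2 / (‖k i‖ ^ 2 * ‖k j‖ ^ 2) := by positivity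
  linarith

/-- Turns the metric condition into a vanishing 2 × 2 minor. -/
theorem LF_eq_delta_iff (k : Module.Basis ι ℂ H) {i j : ι} (h : i ≠ j) (l : ι) :
    LF k i j l = delta k i l ↔ ‖defect k i j l‖ = delta k i j * delta k i l := by
  have h0 := delta_pos k h
  rw [LF, ← defect, one_div, inv_mul_eq_iff_eq_mul₀ h0.ne']

/-- If the McCullough-Quiggin matrix with base point `o` has rank one, then `LF` is `δ`. -/
theorem LF_eq_delta_of_defect_eq (k : Module.Basis ι ℂ H) (o : ι) (u : ι → ℂ)
    (hu : ∀ a b, defect k o a b = conj (u a) * u b) {a : ι} (h : o ≠ a) (b : ι) :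
    LF k o a b = delta k o b := by
  have hd : ∀ c, delta k o c = ‖u c‖ := fun c => by
    have h1 := defect_self k o c
    rw [hu, mul_comm, Complex.mul_conj, Complex.normSq_eq_norm_sq] at h1
    exact ((sq_eq_sq₀ (norm_nonneg _) (delta_nonneg _ _ _)).1 (Complex.ofReal_injective h1)).symm
  rw [LF_eq_delta_iff k h, hd, hd, hu, norm_mul, RCLike.norm_conj]

end Gram

/-! ### Scalar multipliers, their adjoints and norms. -/

section Multiplier

variable {ι H : Type*} [NormedAddCommGroup H] [InnerProductSpace ℂ H]

/-- Multiplication by the scalar function `f`. -/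
noncomputable def scalarMul [Finite ι] (k : Module.Basis ι ℂ H) (f : ι → ℂ) (h : H) : H :=
  (evalEquiv k).symm fun i => f i * evalEquiv k h i

theorem inner_scalarMul [Finite ι] (k : Module.Basis ι ℂ H) (f : ι → ℂ) (h : H) (i : ι) :
    inner ℂ (k i) (scalarMul k f h) = f i * inner ℂ (k i) h := by
  have h1 := congrFun ((evalEquiv k).apply_symm_apply fun i => f i * evalEquiv k h i) i
  exact h1

/-- The adjoint of multiplication by `f`, for which the kernel functions are eigenvectors. -/
noncomputable def coMul (k : Module.Basis ι ℂ H) (f : ι → ℂ) : H →ₗ[ℂ] H :=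
  k.constr ℂ fun i => conj (f i) • k i

theorem coMul_apply (k : Module.Basis ι ℂ H) (f : ι → ℂ) (i : ι) :
    coMul k f (k i) = conj (f i) • k i := k.constr_basis ℂ _ i

theorem inner_coMul [Finite ι] (k : Module.Basis ι ℂ H) (f : ι → ℂ) (x h : H) :
    inner ℂ (coMul k f x) h = inner ℂ x (scalarMul k f h) := by
  have hx : x ∈ Submodule.span ℂ (Set.range k) := k.mem_span x
  induction hx using Submodule.span_induction with
  | mem x hx =>
    obtain ⟨i, rfl⟩ := hx
    rw [coMul_apply, inner_smul_left, inner_scalarMul, RCLike.conj_conj]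
  | zero => simp
  | add x y _ _ hx hy => rw [map_add, inner_add_left, inner_add_left, hx, hy]
  | smul a x _ hx => rw [map_smul, inner_smul_left, inner_smul_left, hx]

/-- Multiplication by `f` inverts its adjoint on vectors where the adjoint attains its norm. -/
theorem scalarMul_coMul_of_norm_eq [Finite ι] (k : Module.Basis ι ℂ H) (f : ι → ℂ)
    (hf : ∀ h, ‖scalarMul k f h‖ ≤ ‖h‖) {v : H} (hv : ‖coMul k f v‖ = ‖v‖) :
    scalarMul k f (coMul k f v) = v := by
  rw [← sub_eq_zero, ← norm_eq_zero, ← sq_eq_zero_iff]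
  refine le_antisymm ?_ (sq_nonneg _)
  -- With `M` the multiplication, `‖M M* v - v‖² = ‖M M* v‖² - 2‖M* v‖² + ‖v‖² ≤ 0`.
  have h1 := inner_coMul k f v (coMul k f v)
  have h2 : RCLike.re (inner ℂ v (scalarMul k f (coMul k f v))) = ‖v‖ ^ 2 := by
    rw [← h1, inner_self_eq_norm_sq, hv]
  have h3 := (hf (coMul k f v)).trans_eq hv
  rw [@norm_sub_sq ℂ, inner_re_symm, h2]
  have h4 := pow_le_pow_left₀ (norm_nonneg _) h3 2
  linarith

theorem norm_scalarMul_le [Finite ι] (k : Module.Basis ι ℂ H) (f : ι → ℂ)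
    (hf : ∀ x, ‖coMul k f x‖ ≤ ‖x‖) (h : H) : ‖scalarMul k f h‖ ≤ ‖h‖ := by
  by_contra! hlt
  have h1 : ‖scalarMul k f h‖ ^ 2 ≤ ‖scalarMul k f h‖ * ‖h‖ := by
    rw [← inner_self_eq_norm_sq (𝕜 := ℂ), ← inner_coMul]
    exact (re_inner_le_norm _ _).trans (mul_le_mul_of_nonneg_right (hf _) (norm_nonneg _))
  nlinarith [norm_nonneg h]

theorem norm_multOp_apply [Finite ι] (k : Module.Basis ι ℂ H)
    (G : ι → Matrix (Fin 1) (Fin 1) ℂ) (h : PiLp 2 fun _ : Fin 1 => H) :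
    ‖multOp k G h‖ = ‖scalarMul k (fun i => G i 0 0) (h 0)‖ := by
  rw [PiLp.norm_eq_of_L2, Fin.sum_univ_one, Real.sqrt_sq (norm_nonneg _)]
  simp only [multOp, scalarMul, LinearMap.coe_mk, AddHom.coe_mk, Matrix.mulVec, dotProduct,
    Fin.sum_univ_one]

theorem norm_piLp_one {H : Type*} [NormedAddCommGroup H] (h : PiLp 2 fun _ : Fin 1 => H) : ‖h‖ = ‖h 0‖ := by
  rw [PiLp.norm_eq_of_L2, Fin.sum_univ_one, Real.sqrt_sq (norm_nonneg _)]

theorem norm_scalarMul_le_of_multNorm [Finite ι] (k : Module.Basis ι ℂ H)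
    (G : ι → Matrix (Fin 1) (Fin 1) ℂ) (hG : multNorm k G = 1) (h : H) :
    ‖scalarMul k (fun i => G i 0 0) h‖ ≤ ‖h‖ := by
  have : FiniteDimensional ℂ H := k.finiteDimensional_of_finite
  have h1 := (LinearMap.toContinuousLinearMap (multOp k G)).le_opNorm (WithLp.toLp 2 fun _ => h)
  rw [LinearMap.coe_toContinuousLinearMap', norm_multOp_apply, norm_piLp_one] at h1
  refine h1.trans_eq ?_
  rw [multNorm] at hG
  rw [hG, one_mul]

/-- The norm is attained at `coMul k f v`, which multiplication by `f` sends back to `v`. The Pick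
property needs norm exactly one, not just a contraction. -/
theorem multNorm_eq_one [Finite ι] (k : Module.Basis ι ℂ H) (f : ι → ℂ)
    (hf : ∀ x, ‖coMul k f x‖ ≤ ‖x‖) {v : H} (hv0 : v ≠ 0) (hv : ‖coMul k f v‖ = ‖v‖) :
    multNorm k (fun i => Matrix.of fun _ _ : Fin 1 => f i) = 1 := by
  have : FiniteDimensional ℂ H := k.finiteDimensional_of_finite
  have hM := norm_scalarMul_le k f hf
  rw [multNorm]
  refine le_antisymm (ContinuousLinearMap.opNorm_le_bound _ zero_le_one fun h => ?_) ?_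
  · rw [LinearMap.coe_toContinuousLinearMap', norm_multOp_apply, norm_piLp_one, one_mul]
    exact hM _
  · have h1 := (LinearMap.toContinuousLinearMap
      (multOp k (fun i => Matrix.of fun _ _ : Fin 1 => f i))).le_opNorm
      (WithLp.toLp 2 fun _ => coMul k f v)
    rw [LinearMap.coe_toContinuousLinearMap', norm_multOp_apply, norm_piLp_one] at h1
    change ‖scalarMul k f (coMul k f v)‖ ≤ _ * ‖coMul k f v‖ at h1
    rw [scalarMul_coMul_of_norm_eq k f hM hv, hv] at h1
    exact le_of_mul_le_mul_right (by rwa [one_mul]) (norm_pos_iff.2 hv0)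

end Multiplier

/-! ### Extending rank one forms by the Pick property. -/

section Pick

variable {ι H : Type*} [NormedAddCommGroup H] [InnerProductSpace ℂ H]

/-- If the McCullough-Quiggin matrix is `conj (f a) * f b`, then the deficiency of the adjoint of
multiplication by `f` is the rank one projection onto the base kernel. -/
theorem inner_sub_inner_coMul {k : Module.Basis ι ℂ H} (hk : IsIrreducible k) (o : ι) (f : ι → ℂ)
    (hf : ∀ a b, defect k o a b = conj (f a) * f b) (v w : H) :
    inner ℂ w v - inner ℂ (coMul k f w) (coMul k f v)
      = inner ℂ w (k o) * inner ℂ (k o) v / gram k o o := by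
  have hw : w ∈ Submodule.span ℂ (Set.range k) := k.mem_span w
  have hv : v ∈ Submodule.span ℂ (Set.range k) := k.mem_span v
  induction hw using Submodule.span_induction with
  | mem w hw =>
    obtain ⟨b, rfl⟩ := hw
    induction hv using Submodule.span_induction with
    | mem v hv =>
      obtain ⟨a, rfl⟩ := hv
      have h1 := gram_mul_one_sub_defect hk o a b
      rw [hf] at h1
      rw [coMul_apply, coMul_apply, inner_smul_left, inner_smul_right, RCLike.conj_conj]
      simp only [gram] at h1 ⊢
      linear_combination h1
    | zero => simp
    | add x y _ _ hx hy =>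
      simp only [map_add, inner_add_right] at hx hy ⊢
      linear_combination hx + hy
    | smul c x _ hx =>
      simp only [map_smul, inner_smul_right] at hx ⊢
      linear_combination c * hx
  | zero => simp
  | add x y _ _ hx hy =>
    simp only [map_add, inner_add_left] at hx hy ⊢
    linear_combination hx + hy
  | smul c x _ hx =>
    simp only [map_smul, inner_smul_left] at hx ⊢
    linear_combination conj c * hx

/-- Hence `coMul k f` is a contraction, isometric exactly on vectors orthogonal to `k o`. -/
theorem norm_sq_coMul {k : Module.Basis ι ℂ H} (hk : IsIrreducible k) (o : ι) (f : ι → ℂ)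
    (hf : ∀ a b, defect k o a b = conj (f a) * f b) (v : H) :
    ‖v‖ ^ 2 - ‖coMul k f v‖ ^ 2 = ‖inner ℂ (k o) v‖ ^ 2 / ‖k o‖ ^ 2 := by
  have h := inner_sub_inner_coMul hk o f hf v v
  rw [inner_self_eq_norm_sq_to_K, inner_self_eq_norm_sq_to_K, ← inner_conj_symm v (k o), mul_comm,
    Complex.mul_conj, Complex.normSq_eq_norm_sq, gram_self] at h
  apply Complex.ofReal_injective
  push_cast at h ⊢
  exact h

/-- The combination of `k a` and `k o` that is orthogonal to `k o`. -/
noncomputable def orthVec (k : Module.Basis ι ℂ H) (o a : ι) : H :=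
  (gram k a o)⁻¹ • k a - (gram k o o)⁻¹ • k o

theorem inner_orthVec {k : Module.Basis ι ℂ H} (hk : IsIrreducible k) (o a : ι) :
    inner ℂ (k o) (orthVec k o a) = 0 := by
  rw [orthVec, inner_sub_right, inner_smul_right, inner_smul_right]
  change (gram k a o)⁻¹ * gram k a o - (gram k o o)⁻¹ * gram k o o = 0
  rw [inv_mul_cancel₀ (hk.ne_zero a o), inv_mul_cancel₀ (hk.ne_zero o o), sub_self]

theorem orthVec_ne_zero {k : Module.Basis ι ℂ H} (hk : IsIrreducible k) {o a : ι} (h : a ≠ o) :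
    orthVec k o a ≠ 0 := by
  intro h0
  have h1 := congrArg (fun v => k.repr v a) h0
  simp [orthVec, h.symm, hk.ne_zero a o] at h1

/-- If on `Y` the McCullough-Quiggin matrix has the rank one form `conj (f a) * f b`, the Pick
property extends this form to every further point. -/
theorem HasCPP.exists_defect_eq [Finite ι] {k : Module.Basis ι ℂ H} (hk : IsIrreducible k)
    (hcpp : HasCPP k) (Y : Set ι) (o a : Y) (hoa : a ≠ o) (f : Y → ℂ)
    (hf : ∀ a b : Y, defect k o a b = conj (f a) * f b) (l : ι) :
    ∃ w : ℂ, ∀ b : Y, defect k o b l = conj (f b) * w := by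
  have hk' := hk.sub Y
  have hf' : ∀ a b : Y, defect (FinRKHS.sub k Y) o a b = conj (f a) * f b := fun a b => by
    rw [defect_sub, hf]
  have hnorm := norm_sq_coMul hk' o f hf'
  have hle : ∀ x, ‖coMul (FinRKHS.sub k Y) f x‖ ≤ ‖x‖ := fun x => by
    refine (sq_le_sq₀ (norm_nonneg _) (norm_nonneg _)).1 ?_
    have h1 : 0 ≤ ‖inner ℂ (FinRKHS.sub k Y o) x‖ ^ 2 / ‖FinRKHS.sub k Y o‖ ^ 2 := by positivity
    linarith [hnorm x]
  have heq : ∀ b, ‖coMul (FinRKHS.sub k Y) f (orthVec (FinRKHS.sub k Y) o b)‖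
      = ‖orthVec (FinRKHS.sub k Y) o b‖ := fun b => by
    refine (sq_eq_sq₀ (norm_nonneg _) (norm_nonneg _)).1 ?_
    have h1 := hnorm (orthVec (FinRKHS.sub k Y) o b)
    rw [inner_orthVec hk', norm_zero, zero_pow two_ne_zero, zero_div] at h1
    linarith
  obtain ⟨G, hG, hG1⟩ := hcpp Y 1 1 _ (multNorm_eq_one _ f hle (orthVec_ne_zero hk' hoa) (heq a))
  have hM := norm_scalarMul_le_of_multNorm k G hG1
  set g : ι → ℂ := fun i => G i 0 0 with hg
  have hgf : ∀ y : Y, g y = f y := fun y => by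
    rw [hg]
    simp only [hG y, Matrix.of_apply]
  have hfo : f o = 0 := by
    have h1 := hf o o
    rw [defect_base_left hk] at h1
    simpa using h1.symm
  have hcoe : ∀ b : Y, ((orthVec (FinRKHS.sub k Y) o b :
      Submodule.span ℂ (Set.range fun y : Y => k y)) : H) = orthVec k o b := fun b => by
    simp only [orthVec, Submodule.coe_sub, Submodule.coe_smul, coe_sub_apply, gram_sub]
  have hcomul : ∀ b : Y, ((coMul (FinRKHS.sub k Y) f (orthVec (FinRKHS.sub k Y) o b) :
      Submodule.span ℂ (Set.range fun y : Y => k y)) : H) = coMul k g (orthVec k o b) :=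
    fun b => by
    simp only [orthVec, map_sub, map_smul, coMul_apply, Submodule.coe_sub, Submodule.coe_smul,
      coe_sub_apply, gram_sub, hgf]
  refine ⟨g l, fun b => ?_⟩
  have h1 : ‖coMul k g (orthVec k o b)‖ = ‖orthVec k o b‖ := by
    rw [← hcomul, ← hcoe]
    exact heq b
  -- Evaluate `M M* v = v` at `l`, for `v = orthVec k o b`. As `f o = 0`, the `k o` term drops out
  -- of `M* v`.
  have h2 := inner_scalarMul k g (coMul k g (orthVec k o b)) l
  rw [scalarMul_coMul_of_norm_eq k g hM h1] at h2
  simp only [orthVec, map_sub, map_smul, coMul_apply, inner_sub_right, inner_smul_right, hgf, hfo,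
    map_zero, zero_mul, mul_zero, sub_zero] at h2
  change (gram k b o)⁻¹ * gram k b l - (gram k o o)⁻¹ * gram k o l
    = g l * ((gram k b o)⁻¹ * (conj (f b) * gram k b l)) at h2
  have n1 := hk.ne_zero b o
  have n2 := hk.ne_zero o o
  have n3 := hk.ne_zero b l
  rw [defect]
  field_simp at h2 ⊢
  linear_combination h2

end Pick

/-! ### Rank one characterizes rescalings of `DA₁(Y)`. -/

section RPick

variable {ι H : Type*} [NormedAddCommGroup H] [InnerProductSpace ℂ H]

theorem gram_da1 (Y : Finset Complex.UnitDisc) (x y : Y) :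
    gram (da1 Y) x y = 1 / (1 - ((y : Complex.UnitDisc) : ℂ) * conj ((x : Complex.UnitDisc) : ℂ)) := by
  rw [gram, Submodule.coe_inner, coe_da1_apply, coe_da1_apply, inner_szego_szego]

theorem one_sub_mul_conj_ne_zero {z w : ℂ} (hz : ‖z‖ < 1) (hw : ‖w‖ < 1) : 1 - z * conj w ≠ 0 := by
  intro h
  have h1 : ‖z * conj w‖ < 1 := by
    rw [norm_mul, RCLike.norm_conj]
    exact mul_lt_one_of_nonneg_of_lt_one_left (norm_nonneg _) hz hw.le
  rw [← sub_eq_zero.1 h, norm_one] at h1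
  exact lt_irrefl _ h1

theorem defect_da1 (Y : Finset Complex.UnitDisc) (o a b : Y) :
    defect (da1 Y) o a b =
      conj ((((a : Complex.UnitDisc) : ℂ) - (o : Complex.UnitDisc)) /
        (1 - ((a : Complex.UnitDisc) : ℂ) * conj ((o : Complex.UnitDisc) : ℂ))) *
      ((((b : Complex.UnitDisc) : ℂ) - (o : Complex.UnitDisc)) /
        (1 - ((b : Complex.UnitDisc) : ℂ) * conj ((o : Complex.UnitDisc) : ℂ))) := by
  simp only [defect, gram_da1]
  have hne : ∀ x y : Y, 1 - ((x : Complex.UnitDisc) : ℂ) * conj ((y : Complex.UnitDisc) : ℂ) ≠ 0 :=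
    fun x y => one_sub_mul_conj_ne_zero (Complex.UnitDisc.norm_lt_one _)
      (Complex.UnitDisc.norm_lt_one _)
  have h1 := hne b a
  have h2 := hne o a
  have h3 := hne b o
  have h4 := hne o o
  simp only [map_div₀, map_sub, map_one, map_mul, RCLike.conj_conj]
  generalize ((o : Complex.UnitDisc) : ℂ) = o at *
  generalize ((a : Complex.UnitDisc) : ℂ) = a at *
  generalize ((b : Complex.UnitDisc) : ℂ) = b at *
  have h5 : 1 - conj a * o ≠ 0 := by rwa [mul_comm]
  field_simp
  ring

theorem IsRescaling.defect_eq {ι' H' : Type*} [NormedAddCommGroup H'] [InnerProductSpace ℂ H']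
    {k : Module.Basis ι ℂ H} {k' : Module.Basis ι' ℂ H'} {Ξ : ι ≃ ι'} {γ : ι → ℂ}
    (hγ : ∀ x, γ x ≠ 0) (h : ∀ x y, gram k' (Ξ x) (Ξ y) = γ x * conj (γ y) * gram k x y)
    (o a b : ι) : defect k o a b = defect k' (Ξ o) (Ξ a) (Ξ b) := by
  simp only [defect, h]
  have h1 : ∀ x, conj (γ x) ≠ 0 := fun x => (map_ne_zero _).2 (hγ x)
  have e : γ a * conj (γ o) * gram k a o * (γ o * conj (γ b) * gram k o b) /
      (γ a * conj (γ b) * gram k a b * (γ o * conj (γ o) * gram k o o)) =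
      ((γ a * conj (γ b) * γ o * conj (γ o)) * (gram k a o * gram k o b)) /
      ((γ a * conj (γ b) * γ o * conj (γ o)) * (gram k a b * gram k o o)) := by
    congr 1 <;> ring
  rw [e, mul_div_mul_left]
  exact mul_ne_zero (mul_ne_zero (mul_ne_zero (hγ a) (h1 b)) (hγ o)) (h1 o)

theorem IsRPick.LF_eq_delta {k : Module.Basis ι ℂ H} (h : IsRPick k) {o a : ι} (hoa : o ≠ a)
    (b : ι) : LF k o a b = delta k o b := by
  obtain ⟨Y, Ξ, γ, hγ, hΞ⟩ := h
  exact LF_eq_delta_of_defect_eq k o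
    (fun c => (((Ξ c : Complex.UnitDisc) : ℂ) - (Ξ o : Complex.UnitDisc)) /
        (1 - ((Ξ c : Complex.UnitDisc) : ℂ) * conj ((Ξ o : Complex.UnitDisc) : ℂ)))
    (fun a b => by rw [IsRescaling.defect_eq hγ hΞ, defect_da1]) hoa b

/-- If the McCullough-Quiggin matrix with base point `o` has rank one, then the space is a rescaling
of a Pick space. -/
theorem isRPick_of_defect_eq [Fintype ι] {k : Module.Basis ι ℂ H} (hk : IsIrreducible k) (o : ι)
    (u : ι → ℂ) (hu : ∀ a b, defect k o a b = conj (u a) * u b) : IsRPick k := by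
  classical
  have hu1 : ∀ a, ‖u a‖ < 1 := fun a => by
    have h1 := defect_self k o a
    rw [hu, mul_comm, Complex.mul_conj, Complex.normSq_eq_norm_sq] at h1
    have h2 := (sq_eq_sq₀ (norm_nonneg _) (delta_nonneg _ _ _)).1 (Complex.ofReal_injective h1)
    exact h2 ▸ delta_lt_one hk o a
  have hgram : ∀ a b, gram k a b * (1 - u b * conj (u a))
      = gram k a o * gram k o b / gram k o o := fun a b => by
    rw [← gram_mul_one_sub_defect hk, hu, mul_comm (u b)]
  let z : ι → Complex.UnitDisc := fun a => Complex.UnitDisc.mk (u a) (hu1 a)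
  have hz : ∀ a, (z a : ℂ) = u a := fun a => Complex.UnitDisc.coe_mk _ _
  have hinj : Function.Injective z := fun a b hab => by
    by_contra hne
    have huab : u a = u b := by rw [← hz, ← hz, hab]
    have h1 := hgram a b
    have h2 := hgram a a
    have h3 := hgram b b
    have h4 := hgram b a
    -- If `u a = u b`, all four entries on `a, b` carry this same factor; cancelling it gives
    -- equality in Cauchy-Schwarz.
    have h0 : 1 - u b * conj (u b) ≠ 0 := one_sub_mul_conj_ne_zero (hu1 b) (hu1 b)
    rw [huab] at h1 h2 h4
    have h5 : gram k a b * gram k b a = gram k a a * gram k b b := by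
      refine mul_right_cancel₀ (mul_ne_zero h0 h0) ?_
      calc _ = gram k a b * (1 - u b * conj (u b)) * (gram k b a * (1 - u b * conj (u b))) := by ring
        _ = gram k a a * (1 - u b * conj (u b)) * (gram k b b * (1 - u b * conj (u b))) := by
          rw [h1, h2, h3, h4]; ring
        _ = _ := by ring
    rw [← conj_gram k a b, Complex.mul_conj, Complex.normSq_eq_norm_sq, gram_self, gram_self,
      ← Complex.ofReal_mul] at h5
    have h6 := Complex.ofReal_injective h5
    rw [← mul_pow] at h6
    exact (norm_gram_lt k hne).ne ((sq_eq_sq₀ (norm_nonneg _) (by positivity)).1 h6)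
  let Ξ : ι ≃ (Finset.univ.image z : Finset Complex.UnitDisc) :=
    Equiv.ofBijective (fun a => ⟨z a, Finset.mem_image_of_mem _ (Finset.mem_univ a)⟩)
      ⟨fun a b hab => hinj (congrArg Subtype.val hab), fun ⟨y, hy⟩ => by
        obtain ⟨a, -, rfl⟩ := Finset.mem_image.1 hy
        exact ⟨a, rfl⟩⟩
  have hΞ : ∀ a, ((Ξ a : Complex.UnitDisc) : ℂ) = u a := hz
  have hko : (‖k o‖ : ℂ) ≠ 0 := by exact_mod_cast norm_ne_zero_iff.2 (k.ne_zero o)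
  -- This weight turns `gram k a b` into `1 / (1 - defect k o a b)`, a Szegő kernel.
  refine ⟨_, Ξ, fun a => ‖k o‖ / gram k a o, fun a => div_ne_zero hko (hk.ne_zero a o),
    fun a b => ?_⟩
  rw [gram_da1, hΞ, hΞ, map_div₀, Complex.conj_ofReal, conj_gram,
    div_eq_iff (one_sub_mul_conj_ne_zero (hu1 b) (hu1 a)), mul_assoc, hgram, gram_self]
  have h1 := hk.ne_zero a o
  have h2 := hk.ne_zero o b
  push_cast
  field_simp

end RPick

/-! ### Four-point Pick property and collinearity give rank one. -/

/-- With the Pick property on all four element sets, collinearity of all triples through the base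
point `o` makes the McCullough-Quiggin matrix with base point `o` of rank one. -/
theorem defect_eq_of_hasCPP {ι H : Type*} [Finite ι] [NormedAddCommGroup H] [InnerProductSpace ℂ H]
    {k : Module.Basis ι ℂ H} (hk : IsIrreducible k)
    (hcpp : ∀ Λ : Set ι, Λ.ncard = 4 → HasCPP (sub k Λ)) {o p : ι} (hop : o ≠ p)
    (hd : ∀ a b, ‖defect k o a b‖ = delta k o a * delta k o b) (a b : ι) :
    defect k o a b = conj (defect k o p a / delta k o p) * (defect k o p b / delta k o p) := by
  have hp : (delta k o p : ℂ) ≠ 0 := by exact_mod_cast (delta_pos k hop).ne'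
  have hpp : defect k o p p = (delta k o p : ℂ) ^ 2 := by rw [defect_self]; push_cast; rfl
  -- The only use of `hd`: the candidate has modulus `delta k o c` at `c`.
  have key : ∀ c, defect k o c c = conj (defect k o p c / delta k o p)
      * (defect k o p c / delta k o p) := fun c => by
    rw [mul_comm, Complex.mul_conj, Complex.normSq_eq_norm_sq, norm_div, hd, Complex.norm_real,
      Real.norm_of_nonneg (delta_nonneg _ _ _), mul_div_cancel_left₀ _ (delta_pos k hop).ne',
      defect_self]
  have hleft : ∀ c, defect k o p c = conj (defect k o p p / delta k o p)
      * (defect k o p c / delta k o p) := fun c => by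
    rw [map_div₀, conj_defect, hpp, Complex.conj_ofReal]
    field_simp
  have hright : ∀ c, defect k o c p = conj (defect k o p c / delta k o p)
      * (defect k o p p / delta k o p) := fun c => by
    rw [map_div₀, conj_defect, hpp, Complex.conj_ofReal]
    field_simp
  by_cases hao : a = o
  · rw [hao, defect_base_left hk, defect_base_right hk, zero_div, map_zero, zero_mul]
  by_cases hbo : b = o
  · rw [hbo, defect_base_right hk, defect_base_right hk, zero_div, mul_zero]
  by_cases hap : a = p
  · rw [hap]; exact hleft b
  by_cases hbp : b = p
  · rw [hbp]; exact hright a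
  by_cases hab : a = b
  · rw [hab]; exact key b
  have hcard : ({o, p, a, b} : Set ι).ncard = 4 := by
    rw [Set.ncard_insert_of_notMem (by simp [hop, Ne.symm hao, Ne.symm hbo]),
      Set.ncard_insert_of_notMem (by simp [Ne.symm hap, Ne.symm hbp]), Set.ncard_pair hab]
  let Λ : Set ι := {o, p, a, b}
  have mo : o ∈ Λ := by simp [Λ]
  have mp : p ∈ Λ := by simp [Λ]
  have ma : a ∈ Λ := by simp [Λ]
  have mb : b ∈ Λ := by simp [Λ]
  -- On `{o, p, a}` the form is known: row and column `o` vanish, row and column `p` hold by the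
  -- choice of candidate, and `key` gives the diagonal.
  let Y : Set Λ := {x | (x : ι) ≠ b}
  let yo : Y := ⟨⟨o, mo⟩, Ne.symm hbo⟩
  let yp : Y := ⟨⟨p, mp⟩, Ne.symm hbp⟩
  let ya : Y := ⟨⟨a, ma⟩, hab⟩
  have hY : ∀ y : Y, y = yo ∨ y = yp ∨ y = ya := by
    rintro ⟨⟨x, hx⟩, hxb⟩
    rcases hx with rfl | rfl | rfl | rfl
    · exact Or.inl rfl
    · exact Or.inr (Or.inl rfl)
    · exact Or.inr (Or.inr rfl)
    · exact absurd rfl hxb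
  obtain ⟨w, hw⟩ := HasCPP.exists_defect_eq (hk.sub Λ) (hcpp Λ hcard) Y yo yp
    (fun h => hop (congrArg (fun y : Y => ((y : Λ) : ι)) h).symm)
    (fun y => defect k o p y / delta k o p) (fun x y => by
      rw [defect_sub]
      rcases hY x with rfl | rfl | rfl
      · change defect k o o _ = conj (defect k o p o / _) * _
        rw [defect_base_left hk, defect_base_right hk, zero_div, map_zero, zero_mul]
      · exact hleft _
      · rcases hY y with rfl | rfl | rfl
        · change defect k o a o = _ * (defect k o p o / _)
          rw [defect_base_right hk, defect_base_right hk, zero_div, mul_zero]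
        · exact hright _
        · exact key a) ⟨b, mb⟩
  have h1 := hw yp
  have h2 := hw ya
  rw [defect_sub] at h1 h2
  change defect k o p b = conj (defect k o p p / delta k o p) * w at h1
  change defect k o a b = conj (defect k o p a / delta k o p) * w at h2
  have h3 : w = defect k o p b / delta k o p := by
    rw [h1, map_div₀, conj_defect, hpp, Complex.conj_ofReal]
    field_simp
  rw [h2, h3]

end FinRKHS

theorem proposition6p10 (m : ℕ) (hm : 4 ≤ m) {H : Type*} [NormedAddCommGroup H]
    [InnerProductSpace ℂ H] (k : Module.Basis (Fin m) ℂ H)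
    (hirr : FinRKHS.IsIrreducible k)
    (hcpp : ∀ Λ : Set (Fin m), Λ.ncard = 4 → FinRKHS.HasCPP (FinRKHS.sub k Λ)) :
    FinRKHS.IsRPick k ↔
      ∀ i j l : Fin m, i < j → j < l → FinRKHS.LF k i j l = FinRKHS.delta k i l := by
  refine ⟨fun h i j l hij _ => h.LF_eq_delta hij.ne l, fun h => ?_⟩
  -- With the least index as base, only triples starting at it are needed; Hermitian symmetry
  -- removes the order on the other two.
  let o : Fin m := ⟨0, by omega⟩
  let p : Fin m := ⟨1, by omega⟩
  have hop : o < p := Fin.mk_lt_mk.2 one_pos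
  have hlt : ∀ a b, a < b → ‖FinRKHS.defect k o a b‖ = FinRKHS.delta k o a * FinRKHS.delta k o b := by
    intro a b hab
    rcases (Fin.mk_le_of_le_val (Nat.zero_le _) : o ≤ a).eq_or_lt with hoa | hoa
    · rw [← hoa]
      have h0 : FinRKHS.delta k o o = 0 := by
        have h1 := FinRKHS.defect_self k o o
        rw [FinRKHS.defect_base_left hirr] at h1
        exact pow_eq_zero_iff two_ne_zero |>.1 (Complex.ofReal_eq_zero.1 h1.symm)
      rw [FinRKHS.defect_base_left hirr, norm_zero, h0, zero_mul]
    · exact (FinRKHS.LF_eq_delta_iff k hoa.ne b).1 (h o a b hoa hab)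
  refine FinRKHS.isRPick_of_defect_eq hirr o _ (FinRKHS.defect_eq_of_hasCPP hirr hcpp hop.ne ?_)
  intro a b
  rcases lt_trichotomy a b with hab | rfl | hab
  · exact hlt a b hab
  · rw [FinRKHS.defect_self, Complex.norm_real, Real.norm_of_nonneg (sq_nonneg _), sq]
  · rw [← FinRKHS.conj_defect, RCLike.norm_conj, hlt b a hab, mul_comm]
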